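/- Setting. Let $n\ge 2$ and let $Ty_n$ be the classical sorted type theory (Gallin's $Ty_n+D$, equivalently Andrews' $Q_0$) with truth type $t$, individual types $e_1,\dots,e_n$, function types $\alpha\beta$ (from $\alpha$ to $\beta$, associated to the right), product types with pairs and projections, and description operators $\iota_{(\alpha t)\alpha}$; write $s=e_n$. Let $\mathcal A=\{a_1,\dots,a_N\}$ be a finite alphabet. $Ty_n^{\mathcal A}$ has, besides arbitrary other non-logical constants, a constant for concatenation $+$ of type $sss$, constants $C^0_s,C^1_s,\dots,C^N_s$, and the axioms $\forall x_s\,(x+C^0=x\wedge C^0+x=x)$, $\forall x_s\forall y_s\forall z_s\,((x+y)+z=x+(y+z))$, and $\forall x_s\forall y_s\forall z_s\,(x+C^i+y\ne x+C^j+z)$ for $1\le i<j\le N$. For a word $w$ over $\mathcal A$ the term $T(w)$ is given by $T(\varepsilon)=C^0_s$, $T(a_i)=C^i_s$, $T(a_iw)=C^i_s+T(w)$ for $w\neq\varepsilon$. Let $Ty_n^{\mathcal A+}$ be an extension of $Ty_n^{\mathcal A}$ by additional constants. $\mathcal T_\alpha$ is the set of $Ty_n^{\mathcal A}$ terms of type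 $\alpha$ (free variables allowed); $\vdash$ is provability in $Ty_n^{\mathcal A}$, and $\Delta\vdash$ is provability from the hypotheses $\Delta$ in $Ty_n^{\mathcal A+}$. Definitions. An $\alpha$-language is a relation $\mathcal L\subseteq\mathcal A^*\times\mathcal T_\alpha$; its range is $\{A\mid (w,A)\in\mathcal L\text{ for some }w\}$. A set $M\subseteq\mathcal T_\alpha$ is logically closed if $B,C\in M$ and $\vdash A=B\vee A=C$ imply $A\in M$. A rule $\mathcal R\subseteq\mathcal T_\alpha\times\mathcal T_\beta$ is logically closed if the image under $\mathcal R$ of every logically closed set is logically closed. For terms $A^1,\dots,A^k$ of type $\alpha$, $\bigvee_{i=1}^k(=A^i)$ denotes $\lambda x_\alpha\,(x=A^1\vee\dots\vee x=A^k)$, with $x$ not free in any $A^i$, and $\lambda x_\alpha\,F$ (with $F$ the false formula) if $k=0$. * A logically closed rule $\mathcal R\subseteq\mathcal T_\alpha\times\mathcal T_\beta$ has the canonic representation $R$ in $D\subseteq\mathcal T_\alpha$, where $R$ is a $Ty_n^{\mathcal A}$ term of type $\alpha\beta t$, if for all $A\in\mathcal T_\alpha$ and $B\in\mathcal T_\beta$: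 $(A,B)\in\mathcal R\iff\ \vdash R\,A\,B$; and for each $A\in D$ there are finitely many (possibly zero) terms $B^1,\dots,B^k\in\mathcal T_\beta$ with $\vdash R\,A=\bigvee_{j=1}^k(=B^j)$. * An $\alpha$-language $\mathcal L$ is represented by $(\Delta,L)$, where $\Delta$ is a consistent set of $Ty_n^{\mathcal A+}$ formulas and $L$ is a $Ty_n^{\mathcal A+}$ term of type $s\alpha t$, if for all $w\in\mathcal A^*$ and $A\in\mathcal T_\alpha$: $(w,A)\in\mathcal L\iff\Delta\vdash L\,T(w)\,A$. * Such a representation is pseudo-canonic if for each word $w$ there are finitely many (possibly zero) terms $A^1,\dots,A^l\in\mathcal T_\alpha$ with $\Delta\vdash L\,T(w)=\bigvee_{i=1}^l(=A^i)$, and if $\Delta$ is conservative over $Ty_n^{\mathcal A}$, i.e. $\vdash A\iff\Delta\vdash A$ for every $Ty_n^{\mathcal A}$ formula $A$. * $\mathcal L\Rightarrow\mathcal R$ is the $\beta$-language $\{(w,B)\mid (w,A)\in\mathcal L\text{ and }(A,B)\in\mathcal R\text{ for some }A\}$. For terms $L$ of type $s\alpha t$ and $R$ of type $\alpha\beta t$,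 the term $L\Rightarrow R$ of type $s\beta t$ is the application to $L$ and $R$ of the operator $\lambda u_{s\alpha t}\,\lambda v_{\alpha\beta t}\,\lambda x_s\,\lambda y_\beta\,\exists z_\alpha\,(u\,x\,z\wedge v\,z\,y)$. Proposition. Let $\alpha,\beta$ be types, let an $\alpha$-language $\mathcal L$ have a pseudo-canonic representation $(\Delta,L)$, and let a logically closed rule $\mathcal R\subseteq\mathcal T_\alpha\times\mathcal T_\beta$ have a canonic representation $R$ in the range of $\mathcal L$. Then the $\beta$-language $\mathcal L\Rightarrow\mathcal R$ is represented by $(\Delta,\,L\Rightarrow R)$, and this representation is again pseudo-canonic. -/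

import Mathlib

universe u v

namespace TyN

/-! ### Types and terms of the sorted type theory `Ty_n` -/

/-- Types of `Ty_n`: the truth type `t`, the individual types `e_1, …, e_n` (indexed by `Fin n`),
functional types (from `a` to `b`) and product types. -/
inductive Ty (n : ℕ) : Type
  | t : Ty n
  | ind (i : Fin n) : Ty n
  | fn (a b : Ty n) : Ty n
  | prod (a b : Ty n) : Ty n

infixr:60 " ⇾ " => Ty.fn

/-- The symbolic type `s`, i.e. the last individual type `e_n`. -/
def Ty.s {n : ℕ} [n.AtLeastTwo] : Ty n :=
  .ind ⟨n - 1, Nat.sub_lt (Nat.lt_of_lt_of_le Nat.zero_lt_two Nat.AtLeastTwo.prop) Nat.one_pos⟩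

/-- `Idx Γ a`: positions (de Bruijn indices) of the type `a` in the list `Γ` of the types of the
variables bound by the surrounding `λ`s. -/
inductive Idx {n : ℕ} : List (Ty n) → Ty n → Type
  | zero {Γ : List (Ty n)} {a : Ty n} : Idx (a :: Γ) a
  | succ {Γ : List (Ty n)} {a b : Ty n} (i : Idx Γ a) : Idx (b :: Γ) a

/-- Terms of `Ty_n` over a family `K` of non-logical constants, up to renaming of bound variables.
`free a k` is the variable `x^k_a` (so there are infinitely many variables of each type); bound
variables are de Bruijn indices into the list `Γ` of the types of the surrounding binders.
The terms of type `a` in the usual sense, with arbitrary free variables, are `Term K [] a`.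
`iota a` is the description operator of type `(a t) a`. -/
inductive Term {n : ℕ} (K : Ty n → Type u) : List (Ty n) → Ty n → Type u
  | free {Γ : List (Ty n)} (a : Ty n) (k : ℕ) : Term K Γ a
  | bound {Γ : List (Ty n)} {a : Ty n} (i : Idx Γ a) : Term K Γ a
  | const {Γ : List (Ty n)} {a : Ty n} (c : K a) : Term K Γ a
  | iota {Γ : List (Ty n)} (a : Ty n) : Term K Γ ((a ⇾ Ty.t) ⇾ a)
  | app {Γ : List (Ty n)} {a b : Ty n} (f : Term K Γ (a ⇾ b)) (x : Term K Γ a) : Term K Γ b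
  | lam {Γ : List (Ty n)} {a b : Ty n} (x : Term K (a :: Γ) b) : Term K Γ (a ⇾ b)
  | eq {Γ : List (Ty n)} {a : Ty n} (x y : Term K Γ a) : Term K Γ Ty.t
  | pair {Γ : List (Ty n)} {a b : Ty n} (x : Term K Γ a) (y : Term K Γ b) : Term K Γ (a.prod b)
  | fst {Γ : List (Ty n)} {a b : Ty n} (x : Term K Γ (a.prod b)) : Term K Γ a
  | snd {Γ : List (Ty n)} {a b : Ty n} (x : Term K Γ (a.prod b)) : Term K Γ b

variable {n : ℕ} {K : Ty n → Type u}

/-- Extension of a renaming of bound variables under one more binder. -/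
def Idx.lift {Γ Γ' : List (Ty n)} (ρ : ∀ a, Idx Γ a → Idx Γ' a) (b : Ty n) :
    ∀ a, Idx (b :: Γ) a → Idx (b :: Γ') a
  | _, .zero => .zero
  | _, .succ i => .succ (ρ _ i)

namespace Term

/-- Renaming of de Bruijn indices. -/
def rename {Γ : List (Ty n)} {a : Ty n} :
    Term K Γ a → ∀ {Γ' : List (Ty n)}, (∀ b, Idx Γ b → Idx Γ' b) → Term K Γ' a
  | free a k, _, _ => free a k
  | bound i, _, ρ => bound (ρ _ i)
  | const c, _, _ => const c
  | iota a, _, _ => iota a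
  | app f x, _, ρ => app (f.rename ρ) (x.rename ρ)
  | lam x, _, ρ => lam (x.rename (Idx.lift ρ _))
  | eq x y, _, ρ => eq (x.rename ρ) (y.rename ρ)
  | pair x y, _, ρ => pair (x.rename ρ) (y.rename ρ)
  | fst x, _, ρ => fst (x.rename ρ)
  | snd x, _, ρ => snd (x.rename ρ)

/-- A term regarded under one more binder (the new bound variable does not occur in it). -/
def wk {Γ : List (Ty n)} {a : Ty n} (b : Ty n) (x : Term K Γ a) : Term K (b :: Γ) a :=
  x.rename (fun _ i => .succ i)

/-- Extension of a substitution for bound variables under one more binder. -/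
def liftSub {Γ Γ' : List (Ty n)} (σ : ∀ a, Idx Γ a → Term K Γ' a) (b : Ty n) :
    ∀ a, Idx (b :: Γ) a → Term K (b :: Γ') a
  | _, .zero => bound .zero
  | _, .succ i => (σ _ i).wk b

/-- Simultaneous (capture-avoiding) substitution for de Bruijn indices. -/
def subst {Γ : List (Ty n)} {a : Ty n} :
    Term K Γ a → ∀ {Γ' : List (Ty n)}, (∀ b, Idx Γ b → Term K Γ' b) → Term K Γ' a
  | free a k, _, _ => free a k
  | bound i, _, σ => σ _ i
  | const c, _, _ => const c
  | iota a, _, _ => iota a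
  | app f x, _, σ => app (f.subst σ) (x.subst σ)
  | lam x, _, σ => lam (x.subst (liftSub σ _))
  | eq x y, _, σ => eq (x.subst σ) (y.subst σ)
  | pair x y, _, σ => pair (x.subst σ) (y.subst σ)
  | fst x, _, σ => fst (x.subst σ)
  | snd x, _, σ => snd (x.subst σ)

/-- The substitution of `y` for the most recently bound variable, identity on the others. -/
def single {Γ : List (Ty n)} {b : Ty n} (y : Term K Γ b) : ∀ a, Idx (b :: Γ) a → Term K Γ a
  | _, .zero => y
  | _, .succ i => bound i

/-- `x.inst y` is the body `x` of an abstraction with `y` put for the abstracted variable. -/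
def inst {Γ : List (Ty n)} {a b : Ty n} (x : Term K (b :: Γ) a) (y : Term K Γ b) : Term K Γ a :=
  x.subst (single y)

/-- Translation of constants, used to regard a term as a term over a larger vocabulary. -/
def mapConst {K' : Ty n → Type v} (f : ∀ a, K a → K' a) {Γ : List (Ty n)} {a : Ty n} :
    Term K Γ a → Term K' Γ a
  | free a k => free a k
  | bound i => bound i
  | const c => const (f _ c)
  | iota a => iota a
  | app g x => app (g.mapConst f) (x.mapConst f)
  | lam x => lam (x.mapConst f)
  | eq x y => eq (x.mapConst f) (y.mapConst f)
  | pair x y => pair (x.mapConst f) (y.mapConst f)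
  | fst x => fst (x.mapConst f)
  | snd x => snd (x.mapConst f)

/-! ### Truth values, connectives and quantifiers, defined from equality as in `Q₀` -/

variable {Γ : List (Ty n)}

/-- Truth, `(λ x_t x) = (λ x_t x)`. -/
def tt : Term K Γ Ty.t := eq (lam (a := Ty.t) (bound .zero)) (lam (bound .zero))

/-- Falsehood, `(λ x_t T) = (λ x_t x)`. -/
def ff : Term K Γ Ty.t := eq (lam (a := Ty.t) tt) (lam (bound .zero))

/-- `∀ x_a A`, that is `(λ x_a T) = (λ x_a A)`. -/
def all {a : Ty n} (A : Term K (a :: Γ) Ty.t) : Term K Γ Ty.t := eq (lam tt) (lam A)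

/-- `¬ A`, that is `F = A`. -/
def neg (A : Term K Γ Ty.t) : Term K Γ Ty.t := eq ff A

/-- `A ∧ B`, that is `(λ g_{ttt} g T T) = (λ g_{ttt} g A B)`. -/
def conj (A B : Term K Γ Ty.t) : Term K Γ Ty.t :=
  eq (lam (a := Ty.t ⇾ Ty.t ⇾ Ty.t) (app (app (bound .zero) tt) tt))
    (lam (app (app (bound .zero) (A.wk _)) (B.wk _)))

/-- `A ∨ B`, that is `¬ (¬ A ∧ ¬ B)`. -/
def disj (A B : Term K Γ Ty.t) : Term K Γ Ty.t := neg (conj (neg A) (neg B))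

/-- `∃ x_a A`, that is `¬ ∀ x_a ¬ A`. -/
def ex {a : Ty n} (A : Term K (a :: Γ) Ty.t) : Term K Γ Ty.t := neg (all (neg A))

/-- The disjunction `(= A₁) ∨ … ∨ (= A_k)` of predicates of type `a t`, that is
`λ x_a (x_a = A₁ ∨ (… ∨ (x_a = A_k ∨ F)))`; for `k = 0` it is `λ x_a F`. -/
def oneOf {a : Ty n} (As : List (Term K Γ a)) : Term K Γ (a ⇾ Ty.t) :=
  lam (As.foldr (fun A φ => disj (eq (bound .zero) (A.wk a)) φ) ff)

end Term

open Term

/-! ### Provability -/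

/-- `Deriv H A`: the formula `A` is provable in `Ty_n` (with description operator and product
types) from the set `H` of hypotheses.  The system has the strength of Andrews' `Q₀`, presented with
hypotheses: equality is a congruence, `β`, `η`, extensionality of the truth type, the two-valuedness
axiom `g T ∧ g F = ∀ x_t g x`, the description axiom `ι (λ x (y = x)) = y`, and pairing. In the
rule `lam` the bound variable must not occur in the hypotheses, so these are weakened; free variables
of the hypotheses are thus never generalized or instantiated. -/
inductive Deriv : {Γ : List (Ty n)} → Set (Term K Γ Ty.t) → Term K Γ Ty.t → Prop
  | hyp {Γ : List (Ty n)} {H : Set (Term K Γ Ty.t)} {A : Term K Γ Ty.t} (h : A ∈ H) : Deriv H A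
  | refl {Γ : List (Ty n)} {H : Set (Term K Γ Ty.t)} {a : Ty n} (x : Term K Γ a) :
      Deriv H (eq x x)
  | symm {Γ : List (Ty n)} {H : Set (Term K Γ Ty.t)} {a : Ty n} {x y : Term K Γ a}
      (h : Deriv H (eq x y)) : Deriv H (eq y x)
  | trans {Γ : List (Ty n)} {H : Set (Term K Γ Ty.t)} {a : Ty n} {x y z : Term K Γ a}
      (h : Deriv H (eq x y)) (h' : Deriv H (eq y z)) : Deriv H (eq x z)
  | app {Γ : List (Ty n)} {H : Set (Term K Γ Ty.t)} {a b : Ty n} {f g : Term K Γ (a ⇾ b)}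
      {x y : Term K Γ a} (h : Deriv H (eq f g)) (h' : Deriv H (eq x y)) :
      Deriv H (eq (app f x) (app g y))
  | lam {Γ : List (Ty n)} {H : Set (Term K Γ Ty.t)} {a b : Ty n} {x y : Term K (a :: Γ) b}
      (h : Deriv (wk a '' H) (eq x y)) : Deriv H (eq (lam x) (lam y))
  | eq {Γ : List (Ty n)} {H : Set (Term K Γ Ty.t)} {a : Ty n} {x y x' y' : Term K Γ a}
      (h : Deriv H (eq x x')) (h' : Deriv H (eq y y')) : Deriv H (eq (eq x y) (eq x' y'))
  | pair {Γ : List (Ty n)} {H : Set (Term K Γ Ty.t)} {a b : Ty n} {x x' : Term K Γ a}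
      {y y' : Term K Γ b} (h : Deriv H (eq x x')) (h' : Deriv H (eq y y')) :
      Deriv H (eq (pair x y) (pair x' y'))
  | fst {Γ : List (Ty n)} {H : Set (Term K Γ Ty.t)} {a b : Ty n} {x y : Term K Γ (a.prod b)}
      (h : Deriv H (eq x y)) : Deriv H (eq (fst x) (fst y))
  | snd {Γ : List (Ty n)} {H : Set (Term K Γ Ty.t)} {a b : Ty n} {x y : Term K Γ (a.prod b)}
      (h : Deriv H (eq x y)) : Deriv H (eq (snd x) (snd y))
  | beta {Γ : List (Ty n)} {H : Set (Term K Γ Ty.t)} {a b : Ty n} (x : Term K (a :: Γ) b)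
      (y : Term K Γ a) : Deriv H (eq (app (lam x) y) (x.inst y))
  | eta {Γ : List (Ty n)} {H : Set (Term K Γ Ty.t)} {a b : Ty n} (f : Term K Γ (a ⇾ b)) :
      Deriv H (eq (lam (app (f.wk a) (bound .zero))) f)
  | fst_pair {Γ : List (Ty n)} {H : Set (Term K Γ Ty.t)} {a b : Ty n} (x : Term K Γ a)
      (y : Term K Γ b) : Deriv H (eq (fst (pair x y)) x)
  | snd_pair {Γ : List (Ty n)} {H : Set (Term K Γ Ty.t)} {a b : Ty n} (x : Term K Γ a)
      (y : Term K Γ b) : Deriv H (eq (snd (pair x y)) y)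
  | pair_eta {Γ : List (Ty n)} {H : Set (Term K Γ Ty.t)} {a b : Ty n} (x : Term K Γ (a.prod b)) :
      Deriv H (eq (pair (fst x) (snd x)) x)
  | eq_mp {Γ : List (Ty n)} {H : Set (Term K Γ Ty.t)} {A B : Term K Γ Ty.t}
      (h : Deriv H (eq A B)) (h' : Deriv H A) : Deriv H B
  | prop_ext {Γ : List (Ty n)} {H : Set (Term K Γ Ty.t)} {A B : Term K Γ Ty.t}
      (h : Deriv (insert A H) B) (h' : Deriv (insert B H) A) : Deriv H (eq A B)
  | bool_cases {Γ : List (Ty n)} {H : Set (Term K Γ Ty.t)} (g : Term K Γ (Ty.t ⇾ Ty.t))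
      (A : Term K Γ Ty.t) (h : Deriv H (app g tt)) (h' : Deriv H (app g ff)) : Deriv H (app g A)
  | iota_eq {Γ : List (Ty n)} {H : Set (Term K Γ Ty.t)} {a : Ty n} (y : Term K Γ a) :
      Deriv H (eq (app (iota a) (lam (eq (y.wk a) (bound .zero)))) y)

/-! ### The symbolic extension `Ty_n^𝒜` for an alphabet with `N` letters -/

/-- Non-logical constants of `Ty_n^𝒜`: the concatenation constant of type `s s s`, the constant for
the empty word, one constant for each of the `N` letters, and arbitrary other constants `C`. -/
inductive SymConst [n.AtLeastTwo] (N : ℕ) (C : Ty n → Type u) : Ty n → Type u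
  | cat : SymConst N C (Ty.s ⇾ Ty.s ⇾ Ty.s)
  | empty : SymConst N C Ty.s
  | letter (i : Fin N) : SymConst N C Ty.s
  | other {a : Ty n} (c : C a) : SymConst N C a

section Symbolic

variable [n.AtLeastTwo] {N : ℕ} {C : Ty n → Type u} {D : Ty n → Type v}

/-- The terms of type `a` of `Ty_n^𝒜` (with arbitrary free variables). -/
abbrev Tm (N : ℕ) (C : Ty n → Type u) (a : Ty n) : Type u := Term (SymConst N C) [] a

/-- Constants of an extension: the constants `C` together with the additional constants `D`. -/
abbrev Plus (C : Ty n → Type u) (D : Ty n → Type v) : Ty n → Type (max u v) :=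
  fun a => C a ⊕ D a

/-- The inclusion of the constants of `Ty_n^𝒜` into those of its extension. -/
def SymConst.emb (D : Ty n → Type v) : ∀ a, SymConst N C a → SymConst N (Plus C D) a
  | _, .cat => .cat
  | _, .empty => .empty
  | _, .letter i => .letter i
  | _, .other c => .other (.inl c)

/-- A term of `Ty_n^𝒜` regarded as a term of its extension by the constants `D`. -/
def emb (D : Ty n → Type v) {a : Ty n} (x : Tm N C a) : Tm N (Plus C D) a :=
  x.mapConst (SymConst.emb D)

/-- The term `x + y` of type `s`. -/
def cat {Γ : List (Ty n)} (x y : Term (SymConst N C) Γ Ty.s) : Term (SymConst N C) Γ Ty.s :=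
  app (app (const .cat) x) y

/-- The term `T_𝒜(w)` that denotes the word `w`. -/
def wordTerm : List (Fin N) → Tm N C Ty.s
  | [] => const .empty
  | [i] => const (.letter i)
  | i :: j :: w => cat (const (.letter i)) (wordTerm (j :: w))

/-- The non-logical axioms of `Ty_n^𝒜`: the empty word is neutral, concatenation is associative, and
`∀ x y z, x + a_i + y ≠ x + a_j + z` for distinct letters `a_i`, `a_j`, `i < j`. -/
inductive SymAxiom : Tm N C Ty.t → Prop
  | neutral : SymAxiom (all (a := Ty.s) (conj
      (eq (cat (bound .zero) (const .empty)) (bound .zero))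
      (eq (cat (const .empty) (bound .zero)) (bound .zero))))
  | assoc : SymAxiom (all (a := Ty.s) (all (a := Ty.s) (all (a := Ty.s)
      (eq (cat (cat (bound (.succ (.succ .zero))) (bound (.succ .zero))) (bound .zero))
        (cat (bound (.succ (.succ .zero))) (cat (bound (.succ .zero)) (bound .zero)))))))
  | letters (i j : Fin N) (h : i < j) :
      SymAxiom (all (a := Ty.s) (all (a := Ty.s) (all (a := Ty.s) (neg
        (eq (cat (cat (bound (.succ (.succ .zero))) (const (.letter i))) (bound (.succ .zero)))
          (cat (cat (bound (.succ (.succ .zero))) (const (.letter j))) (bound .zero)))))))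

/-- `Proves Δ A`: the formula `A` is provable from `Δ` in `Ty_n^𝒜` (in its extension, when the
constants are those of an extension). -/
def Proves (Δ : Set (Tm N C Ty.t)) (A : Tm N C Ty.t) : Prop :=
  Deriv ({B | SymAxiom B} ∪ Δ) A

/-- A set of formulas is consistent if it does not prove `F`. -/
def Consistent (Δ : Set (Tm N C Ty.t)) : Prop := ¬ Proves Δ ff

/-! ### Languages and semantic rules -/

/-- An `a`-language: a relation between words and terms of type `a`. -/
abbrev Language (N : ℕ) (C : Ty n → Type u) (a : Ty n) : Type u := Set (List (Fin N) × Tm N C a)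

/-- A semantic rule: a relation between terms of type `a` and terms of type `b`. -/
abbrev Rule (N : ℕ) (C : Ty n → Type u) (a b : Ty n) : Type u := Set (Tm N C a × Tm N C b)

variable {a b : Ty n}

/-- The set of all meanings that a language can express. -/
def Language.range (𝓛 : Language N C a) : Set (Tm N C a) := {A | ∃ w, (w, A) ∈ 𝓛}

/-- The application of a semantic rule to a language. -/
def Language.applyRule (𝓛 : Language N C a) (𝓡 : Rule N C a b) : Language N C b :=
  {p | ∃ A, (p.1, A) ∈ 𝓛 ∧ (A, p.2) ∈ 𝓡}

/-- A set `M` of terms is logically closed if `A ∈ M` whenever `A = B ∨ A = B'` is provable for some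
`B` and `B'` in `M`. -/
def LogicallyClosed (M : Set (Tm N C a)) : Prop :=
  ∀ A B B', B ∈ M → B' ∈ M → Proves ∅ (disj (eq A B) (eq A B')) → A ∈ M

/-- A rule is logically closed if the full image of every logically closed set is. -/
def Rule.LogicallyClosed (𝓡 : Rule N C a b) : Prop :=
  ∀ M : Set (Tm N C a), TyN.LogicallyClosed M → TyN.LogicallyClosed {B | ∃ A ∈ M, (A, B) ∈ 𝓡}

/-- The logically closed rule `𝓡` has the canonic representation `R` in the set `M` of terms. -/
structure Rule.IsCanonicRep (𝓡 : Rule N C a b) (M : Set (Tm N C a)) (R : Tm N C (a ⇾ b ⇾ Ty.t)) :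
    Prop where
  logicallyClosed : 𝓡.LogicallyClosed
  mem_iff : ∀ A B, (A, B) ∈ 𝓡 ↔ Proves ∅ (app (app R A) B)
  eq_oneOf : ∀ A ∈ M, ∃ Bs : List (Tm N C b), Proves ∅ (eq (app R A) (oneOf Bs))

/-- The language `𝓛` is represented by `(Δ, L)`, where `Δ` is a consistent set of formulas and `L` a
term of an extension of `Ty_n^𝒜` by additional constants `D`. -/
structure Language.IsRepresentedBy (𝓛 : Language N C a) (Δ : Set (Tm N (Plus C D) Ty.t))
    (L : Tm N (Plus C D) (Ty.s ⇾ a ⇾ Ty.t)) : Prop where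
  consistent : Consistent Δ
  mem_iff : ∀ w A, (w, A) ∈ 𝓛 ↔ Proves Δ (app (app L (wordTerm w)) (emb D A))

/-- `(Δ, L)` is a pseudo-canonic representation of the language `𝓛`. -/
structure Language.IsPseudoCanonicRep (𝓛 : Language N C a) (Δ : Set (Tm N (Plus C D) Ty.t))
    (L : Tm N (Plus C D) (Ty.s ⇾ a ⇾ Ty.t)) : Prop where
  represented : 𝓛.IsRepresentedBy Δ L
  eq_oneOf : ∀ w, ∃ As : List (Tm N C a),
    Proves Δ (eq (app L (wordTerm w)) (oneOf (As.map (emb D))))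
  conservative : ∀ A : Tm N C Ty.t, Proves ∅ A ↔ Proves Δ (emb D A)

/-- The semantic rule application operator of type `(s a t) (a b t) s b t`, that is
`λ x_{s a t} λ y_{a b t} λ x_s λ x_b ∃ x_a (x_{s a t} x_s x_a ∧ y_{a b t} x_a x_b)`. -/
def ruleOp (K : Ty n → Type u) (a b : Ty n) :
    Term K [] ((Ty.s ⇾ a ⇾ Ty.t) ⇾ (a ⇾ b ⇾ Ty.t) ⇾ Ty.s ⇾ b ⇾ Ty.t) :=
  lam (lam (lam (lam (ex (a := a) (conj
    (app (app (bound (.succ (.succ (.succ (.succ .zero))))) (bound (.succ (.succ .zero))))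
      (bound .zero))
    (app (app (bound (.succ (.succ (.succ .zero)))) (bound .zero)) (bound (.succ .zero))))))))

/-- The term `L ⇒ R`. -/
def ruleApp {K : Ty n → Type u} (L : Term K [] (Ty.s ⇾ a ⇾ Ty.t))
    (R : Term K [] (a ⇾ b ⇾ Ty.t)) : Term K [] (Ty.s ⇾ b ⇾ Ty.t) :=
  app (app (ruleOp K a b) L) R

end Symbolic

end TyN

namespace TyN

variable {n : ℕ} {K : Ty n → Type u} {Γ : List (Ty n)}

/-! ### Renaming and substitution -/

namespace Term

/-! Write `L T(w)` as the finite disjunction of the `(= Aᵢ)`. By reflexivity each `(w, Aᵢ)` is in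
the language, so `Aᵢ` lies in its range and `R Aᵢ` is in turn a finite disjunction of `(= Bᵢⱼ)`.
Hence `(L ⇒ R) T(w)` is the disjunction of all `(= Bᵢⱼ)` (`ruleApp_oneOf`). Consistency and
conservativity concern `Δ` alone and carry over.

For representation, a pair of `𝓛 ⇒ 𝓡` gives an explicit witness of the existential quantifier.
Conversely, if `Δ` proves `(L ⇒ R) T(w) B`, then it proves that `B` is one of the `Bᵢⱼ`, and by
conservativity so does `Ty_n^𝒜`. The `Bᵢⱼ` lie in the image under `𝓡` of `{A | (w, A) ∈ 𝓛}`. That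
set is logically closed, hence so is its image, and `B` belongs to it.

The last inference needs `LogicallyClosed.mem_of_oneOf`: closure is stated for two alternatives,
while here there are finitely many. Longer disjunctions are reduced to two alternatives with a term
defined by cases through description (`cond`). The empty disjunction is excluded by consistency. -/

theorem rename_rename {a : Ty n} (x : Term K Γ a) {Γ' Γ'' : List (Ty n)}
    (ρ : ∀ b, Idx Γ b → Idx Γ' b) (ρ' : ∀ b, Idx Γ' b → Idx Γ'' b) :
    (x.rename ρ).rename ρ' = x.rename (fun b i => ρ' b (ρ b i)) := by
  induction x generalizing Γ' Γ'' with
  | lam x ih =>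
    simp only [rename, ih]
    congr 2
    funext c i
    cases i <;> rfl
  | _ => simp_all only [rename]

theorem subst_rename {a : Ty n} (x : Term K Γ a) {Γ' Γ'' : List (Ty n)}
    (ρ : ∀ b, Idx Γ b → Idx Γ' b) (σ : ∀ b, Idx Γ' b → Term K Γ'' b) :
    (x.rename ρ).subst σ = x.subst (fun b i => σ b (ρ b i)) := by
  induction x generalizing Γ' Γ'' with
  | lam x ih =>
    simp only [rename, subst, ih]
    congr 2
    funext c i
    cases i <;> rfl
  | _ => simp_all only [rename, subst]

theorem wk_rename {a c : Ty n} (x : Term K Γ a) {Γ' : List (Ty n)}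
    (ρ : ∀ b, Idx Γ b → Idx Γ' b) :
    (x.wk c).rename (Idx.lift ρ c) = (x.rename ρ).wk c := by
  simp only [wk, rename_rename, Idx.lift]

theorem rename_subst {a : Ty n} (x : Term K Γ a) {Γ' Γ'' : List (Ty n)}
    (σ : ∀ b, Idx Γ b → Term K Γ' b) (ρ : ∀ b, Idx Γ' b → Idx Γ'' b) :
    (x.subst σ).rename ρ = x.subst (fun b i => (σ b i).rename ρ) := by
  induction x generalizing Γ' Γ'' with
  | lam x ih =>
    simp only [rename, subst, ih]
    congr 2
    funext c i
    cases i with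
    | zero => rfl
    | succ i => exact wk_rename _ _
  | _ => simp_all only [rename, subst]

theorem subst_bound {a : Ty n} (x : Term K Γ a) : x.subst (fun _ i => bound i) = x := by
  induction x with
  | @lam Γ a b x ih =>
    simp only [subst]
    congr 1
    have h : (liftSub (fun _ i => bound i) a : ∀ c, Idx (a :: Γ) c → Term K (a :: Γ) c) =
        fun _ i => bound i := by
      funext c i
      cases i <;> rfl
    rw [h, ih]
  | _ => simp_all only [subst]

theorem subst_bound_comp {a : Ty n} (x : Term K Γ a) {Γ' : List (Ty n)}
    (ρ : ∀ b, Idx Γ b → Idx Γ' b) : x.subst (fun b i => bound (ρ b i)) = x.rename ρ := by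
  rw [← subst_bound (x.rename ρ), subst_rename]

theorem wk_subst {a c : Ty n} (x : Term K Γ a) {Γ' : List (Ty n)}
    (σ : ∀ b, Idx Γ b → Term K Γ' b) :
    (x.wk c).subst (liftSub σ c) = (x.subst σ).wk c := by
  simp only [wk, subst_rename, rename_subst, liftSub]

@[simp]
theorem wk_subst_single {a c : Ty n} (x : Term K Γ a) (y : Term K Γ c) :
    (x.wk c).subst (single y) = x := by
  simp only [wk, subst_rename, single, subst_bound]

@[simp]
theorem wk_inst {a c : Ty n} (x : Term K Γ a) (y : Term K Γ c) : (x.wk c).inst y = x :=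
  wk_subst_single x y

theorem inst_rename {a c : Ty n} (x : Term K (c :: Γ) a) (y : Term K Γ c) {Γ' : List (Ty n)}
    (ρ : ∀ b, Idx Γ b → Idx Γ' b) :
    (x.inst y).rename ρ = (x.rename (Idx.lift ρ c)).inst (y.rename ρ) := by
  simp only [inst, rename_subst, subst_rename]
  congr 1
  funext d i
  cases i <;> rfl

theorem mapConst_rename {K' : Ty n → Type v} (f : ∀ a, K a → K' a) {a : Ty n} (x : Term K Γ a)
    {Γ' : List (Ty n)} (ρ : ∀ b, Idx Γ b → Idx Γ' b) :
    (x.rename ρ).mapConst f = (x.mapConst f).rename ρ := by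
  induction x generalizing Γ' <;> simp_all only [rename, mapConst]

theorem mapConst_wk {K' : Ty n → Type v} (f : ∀ a, K a → K' a) {a : Ty n} (x : Term K Γ a)
    (c : Ty n) : (x.wk c).mapConst f = (x.mapConst f).wk c :=
  mapConst_rename f x _

/-! ### Defined connectives under renaming, substitution and change of constants. -/

section Connectives

variable {Γ' : List (Ty n)} (ρ : ∀ b, Idx Γ b → Idx Γ' b) (σ : ∀ b, Idx Γ b → Term K Γ' b)

@[simp] theorem tt_rename : (tt : Term K Γ Ty.t).rename ρ = tt := rfl
@[simp] theorem tt_subst : (tt : Term K Γ Ty.t).subst σ = tt := rfl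

@[simp] theorem neg_rename (A : Term K Γ Ty.t) : (neg A).rename ρ = neg (A.rename ρ) := rfl
@[simp] theorem neg_subst (A : Term K Γ Ty.t) : (neg A).subst σ = neg (A.subst σ) := rfl

@[simp] theorem conj_rename (A B : Term K Γ Ty.t) :
    (conj A B).rename ρ = conj (A.rename ρ) (B.rename ρ) := by
  simp only [conj, rename, wk_rename, tt_rename, Idx.lift]

@[simp] theorem conj_subst (A B : Term K Γ Ty.t) :
    (conj A B).subst σ = conj (A.subst σ) (B.subst σ) := by
  simp only [conj, subst, wk_subst, tt_subst, liftSub]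

@[simp] theorem disj_rename (A B : Term K Γ Ty.t) :
    (disj A B).rename ρ = disj (A.rename ρ) (B.rename ρ) := by
  simp only [disj, neg_rename, conj_rename]

@[simp] theorem disj_subst (A B : Term K Γ Ty.t) :
    (disj A B).subst σ = disj (A.subst σ) (B.subst σ) := by
  simp only [disj, neg_subst, conj_subst]

@[simp] theorem ex_subst {a : Ty n} (A : Term K (a :: Γ) Ty.t) :
    (ex A).subst σ = ex (A.subst (liftSub σ a)) := rfl

@[simp] theorem oneOf_rename {a : Ty n} (As : List (Term K Γ a)) :
    (oneOf As).rename ρ = oneOf (As.map (rename · ρ)) := by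
  simp only [oneOf, rename]
  congr 1
  induction As with
  | nil => rfl
  | cons A As ih =>
    simp only [List.foldr_cons, List.map_cons, disj_rename, ih, rename, wk_rename, Idx.lift]

theorem oneOf_wk {a : Ty n} (As : List (Term K Γ a)) (c : Ty n) :
    (oneOf As).wk c = oneOf (As.map (wk c)) :=
  oneOf_rename _ As

theorem app_wk {a b : Ty n} (f : Term K Γ (a ⇾ b)) (x : Term K Γ a) (c : Ty n) :
    (app f x).wk c = app (f.wk c) (x.wk c) := rfl

theorem eq_wk {a : Ty n} (x y : Term K Γ a) (c : Ty n) :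
    (eq x y).wk c = eq (x.wk c) (y.wk c) := rfl

theorem mapConst_disj {K' : Ty n → Type v} (f : ∀ a, K a → K' a) (A B : Term K Γ Ty.t) :
    (disj A B).mapConst f = disj (A.mapConst f) (B.mapConst f) := by
  simp only [disj, neg, conj, tt, ff, mapConst, mapConst_wk]

theorem mapConst_oneOf {K' : Ty n → Type v} (f : ∀ a, K a → K' a) {a : Ty n}
    (As : List (Term K Γ a)) : (oneOf As).mapConst f = oneOf (As.map (mapConst f)) := by
  simp only [oneOf, mapConst]
  congr 1
  induction As with
  | nil => rfl
  | cons A As ih =>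
    simp only [List.foldr_cons, List.map_cons, mapConst_disj, ih, mapConst, mapConst_wk]

end Connectives

end Term

open Term

/-! ### Derived rules -/

namespace Deriv

variable {H : Set (Term K Γ Ty.t)} {A B P : Term K Γ Ty.t}

theorem mono {H' : Set (Term K Γ Ty.t)} (h : Deriv H A) (hH : H ⊆ H') : Deriv H' A := by
  induction h with
  | hyp h => exact hyp (hH h)
  | refl x => exact refl x
  | symm _ ih => exact symm (ih hH)
  | trans _ _ ih ih' => exact trans (ih hH) (ih' hH)
  | app _ _ ih ih' => exact app (ih hH) (ih' hH)
  | lam _ ih => exact lam (ih (Set.image_mono hH))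
  | eq _ _ ih ih' => exact eq (ih hH) (ih' hH)
  | pair _ _ ih ih' => exact pair (ih hH) (ih' hH)
  | fst _ ih => exact fst (ih hH)
  | snd _ ih => exact snd (ih hH)
  | beta x y => exact beta x y
  | eta f => exact eta f
  | fst_pair x y => exact fst_pair x y
  | snd_pair x y => exact snd_pair x y
  | pair_eta x => exact pair_eta x
  | eq_mp _ _ ih ih' => exact eq_mp (ih hH) (ih' hH)
  | prop_ext _ _ ih ih' =>
    exact prop_ext (ih (Set.insert_subset_insert hH)) (ih' (Set.insert_subset_insert hH))
  | bool_cases g A _ _ ih ih' => exact bool_cases g A (ih hH) (ih' hH)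
  | iota_eq y => exact iota_eq y

theorem insert (h : Deriv H A) : Deriv (insert B H) A :=
  h.mono (Set.subset_insert _ _)

theorem assumption : Deriv (Insert.insert A H) A :=
  hyp (Set.mem_insert _ _)

theorem rename {Γ' : List (Ty n)} (h : Deriv H A) (ρ : ∀ b, Idx Γ b → Idx Γ' b) :
    Deriv ((fun B => B.rename ρ) '' H) (A.rename ρ) := by
  induction h generalizing Γ' with
  | hyp h => exact hyp (Set.mem_image_of_mem _ h)
  | refl x => exact refl _
  | symm _ ih => exact symm (ih ρ)
  | trans _ _ ih ih' => exact trans (ih ρ) (ih' ρ)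
  | app _ _ ih ih' => exact app (ih ρ) (ih' ρ)
  | lam _ ih =>
    refine lam ((ih (Idx.lift ρ _)).mono ?_)
    rintro _ ⟨_, ⟨B, hB, rfl⟩, rfl⟩
    exact ⟨_, ⟨B, hB, rfl⟩, (wk_rename B ρ).symm⟩
  | eq _ _ ih ih' => exact eq (ih ρ) (ih' ρ)
  | pair _ _ ih ih' => exact pair (ih ρ) (ih' ρ)
  | fst _ ih => exact fst (ih ρ)
  | snd _ ih => exact snd (ih ρ)
  | beta x y =>
    simp only [Term.rename, inst_rename]
    exact beta _ _
  | eta f =>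
    simp only [Term.rename, wk_rename, Idx.lift]
    exact eta _
  | fst_pair x y => exact fst_pair _ _
  | snd_pair x y => exact snd_pair _ _
  | pair_eta x => exact pair_eta _
  | eq_mp _ _ ih ih' => exact eq_mp (ih ρ) (ih' ρ)
  | prop_ext _ _ ih ih' =>
    refine prop_ext ?_ ?_
    · simpa only [Set.image_insert_eq] using ih ρ
    · simpa only [Set.image_insert_eq] using ih' ρ
  | bool_cases g A _ _ ih ih' => exact bool_cases _ _ (ih ρ) (ih' ρ)
  | iota_eq y =>
    simp only [Term.rename, wk_rename, Idx.lift]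
    exact iota_eq _

theorem wk (h : Deriv H A) (c : Ty n) : Deriv (Term.wk c '' H) (A.wk c) :=
  h.rename _

theorem truth : Deriv H tt := refl _

theorem eq_tt (h : Deriv H A) : Deriv H (.eq A tt) :=
  prop_ext truth h.insert

theorem of_eq_tt (h : Deriv H (.eq A tt)) : Deriv H A :=
  eq_mp h.symm truth

theorem inst_congr {a b : Ty n} (x : Term K (a :: Γ) b) {y z : Term K Γ a}
    (h : Deriv H (.eq y z)) : Deriv H (.eq (x.inst y) (x.inst z)) :=
  ((beta x y).symm.trans (app (refl _) h)).trans (beta x z)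

theorem conj_intro (h : Deriv H A) (h' : Deriv H B) : Deriv H (conj A B) :=
  lam (app (app (refl _) (h.eq_tt.symm.wk _)) (h'.eq_tt.symm.wk _))

/-- A conjunction is an equation between functions of `g`; both sides are applied to `f`. Taking a
projection for `f` recovers each conjunct. -/
theorem app_conj (h : Deriv H (conj A B)) (f : Term K Γ (Ty.t ⇾ Ty.t ⇾ Ty.t)) :
    Deriv H (.eq (.app (.app f tt) tt) (.app (.app f A) B)) := by
  have h1 := ((beta _ f).symm.trans (app h (refl f))).trans (beta _ f)
  simpa only [inst, subst, tt_subst, single, wk_subst_single] using h1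

theorem app_fst (A B : Term K Γ Ty.t) :
    Deriv H (.eq (.app (.app (.lam (.lam (.bound (.succ .zero)))) A) B) A) := by
  have h2 := beta (H := H) (A.wk Ty.t) B
  rw [wk_inst] at h2
  exact (app (beta _ _) (refl _)).trans h2

theorem app_snd (A B : Term K Γ Ty.t) :
    Deriv H (.eq (.app (.app (.lam (.lam (.bound .zero))) A) B) B) :=
  (app (beta _ _) (refl _)).trans (beta _ _)

theorem conj_left (h : Deriv H (conj A B)) : Deriv H A :=
  of_eq_tt (((app_fst A B).symm.trans (h.app_conj _).symm).trans (app_fst _ _))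

theorem conj_right (h : Deriv H (conj A B)) : Deriv H B :=
  of_eq_tt (((app_snd A B).symm.trans (h.app_conj _).symm).trans (app_snd _ _))

/-- There is no primitive implication: the entailment of `B` by `A` is internalized as the equation
of `A` with `A ∧ B`. -/
theorem cut (h : Deriv H A) (h' : Deriv (Insert.insert A H) B) : Deriv H B :=
  (eq_mp (prop_ext (conj_intro assumption h') assumption.conj_left) h).conj_right

/-- Falsehood equates the constant function `T` with the identity on truth values; evaluating both
at `A` gives `A = T`. -/
theorem ff_elim (h : Deriv H ff) : Deriv H A :=
  of_eq_tt (((beta (.bound .zero) A).symm.trans (app h.symm (refl A))).trans (beta _ _))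

theorem neg_intro (h : Deriv (Insert.insert A H) ff) : Deriv H (neg A) :=
  prop_ext assumption.ff_elim h

theorem neg_elim (h : Deriv H (neg A)) (h' : Deriv H A) : Deriv H B :=
  (eq_mp h.symm h').ff_elim

theorem by_cases (A : Term K Γ Ty.t) (h : Deriv (Insert.insert A H) B)
    (h' : Deriv (Insert.insert (neg A) H) B) : Deriv H B := by
  -- `g p` encodes "`A = p` implies `B`". Two-valuedness yields `g A` from `g T` and `g F`, and `A =
  -- A` then releases `B`.
  set g : Term K Γ (Ty.t ⇾ Ty.t) :=
    .lam (.eq (.eq (A.wk _) (.bound .zero)) (conj (.eq (A.wk _) (.bound .zero)) (B.wk _)))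
  have hbeta (p : Term K Γ Ty.t) :
      Deriv H (.eq (.app g p) (.eq (.eq A p) (conj (.eq A p) B))) := by
    have := beta (H := H)
      (.eq (.eq (A.wk _) (.bound .zero)) (conj (.eq (A.wk _) (.bound .zero)) (B.wk _))) p
    simpa only [inst, subst, conj_subst, single, wk_subst_single] using this
  have hg_intro {p : Term K Γ Ty.t} (hp : Deriv (Insert.insert (.eq A p) H) B) :
      Deriv H (.app g p) :=
    eq_mp (hbeta p).symm (prop_ext (conj_intro assumption hp) assumption.conj_left)
  have hA : Deriv H (.app g A) := by
    refine bool_cases g A (hg_intro ?_) (hg_intro ?_)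
    · exact cut assumption.of_eq_tt (h.mono (Set.insert_subset_insert (Set.subset_insert _ _)))
    · exact cut assumption.symm (h'.mono (Set.insert_subset_insert (Set.subset_insert _ _)))
  exact (eq_mp (eq_mp (hbeta A) hA) (refl A)).conj_right

theorem disj_inl (h : Deriv H A) : Deriv H (disj A B) :=
  neg_intro (neg_elim assumption.conj_left h.insert)

theorem disj_inr (h : Deriv H B) : Deriv H (disj A B) :=
  neg_intro (neg_elim assumption.conj_right h.insert)

theorem disj_elim (h : Deriv H (disj A B)) (hA : Deriv (Insert.insert A H) P)
    (hB : Deriv (Insert.insert B H) P) : Deriv H P :=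
  by_cases A hA <| by_cases B (hB.mono (Set.insert_subset_insert (Set.subset_insert _ _)))
    (neg_elim h.insert.insert (conj_intro assumption.insert assumption))

theorem all_intro {a : Ty n} {A : Term K (a :: Γ) Ty.t} (h : Deriv (Term.wk a '' H) A) :
    Deriv H (all A) :=
  lam h.eq_tt.symm

theorem all_elim {a : Ty n} {A : Term K (a :: Γ) Ty.t} (h : Deriv H (all A)) (y : Term K Γ a) :
    Deriv H (A.inst y) :=
  of_eq_tt (((beta A y).symm.trans (app h.symm (refl y))).trans (beta _ _))

theorem ex_intro {a : Ty n} {A : Term K (a :: Γ) Ty.t} (y : Term K Γ a)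
    (h : Deriv H (A.inst y)) : Deriv H (ex A) :=
  neg_intro (neg_elim (A := A.inst y) (all_elim assumption y) h.insert)

theorem ex_elim {a : Ty n} {A : Term K (a :: Γ) Ty.t} (h : Deriv H (ex A))
    (h' : Deriv (Insert.insert A (Term.wk a '' H)) (B.wk a)) : Deriv H B := by
  refine by_cases B assumption (neg_elim h.insert (all_intro (neg_intro ?_)))
  rw [Set.image_insert_eq]
  -- The hypothesis selected is the weakened `¬ B`, which the case distinction on `B` supplied.
  refine neg_elim (A := B.wk a) (hyp (Or.inr (Or.inl rfl))) (h'.mono ?_)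
  exact Set.insert_subset_insert (Set.subset_insert _ _)

/-! ### Finite disjunctions of predicates `(= A)` -/

theorem app_oneOf_nil {a : Ty n} (x : Term K Γ a) : Deriv H (.eq (.app (oneOf []) x) ff) :=
  beta _ _

/-- Unfolding `oneOf` exposes the raw body of the tail, so the tail is first β-expanded, under the
binder, to `oneOf As` applied to the bound variable. -/
theorem app_oneOf_cons {a : Ty n} (x A : Term K Γ a) (As : List (Term K Γ a)) :
    Deriv H (.eq (.app (oneOf (A :: As)) x) (disj (.eq x A) (.app (oneOf As) x))) := by
  have h := beta (H := H)
    (disj (.eq (.bound .zero) (A.wk a)) (.app ((oneOf As).wk a) (.bound .zero))) x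
  simp only [inst, disj_subst, subst, single, wk_subst_single] at h
  refine trans (app (lam ?_) (refl x)) h
  have hbeta := beta (H := Term.wk a '' H)
    ((As.foldr (fun A φ => disj (.eq (.bound .zero) (A.wk a)) φ) ff).rename
      (Idx.lift (fun _ i => .succ i) a)) (.bound .zero)
  -- Shifting past a new variable and then instantiating with the old one is the identity.
  have hid : ((As.foldr (fun A φ => disj (.eq (.bound .zero) (A.wk a)) φ) ff).rename
      (Idx.lift (fun _ i => .succ i) a)).inst (.bound .zero) =
      As.foldr (fun A φ => disj (.eq (.bound .zero) (A.wk a)) φ) ff := by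
    rw [inst, subst_rename]
    convert subst_bound _ with c i
    cases i <;> rfl
  rw [hid] at hbeta
  -- The extra variable of type `t` marks the hole in which the tail is replaced.
  have h' := inst_congr (disj (.eq (.bound (.succ .zero)) ((A.wk a).wk _)) (.bound .zero)) hbeta.symm
  simp only [inst, disj_subst, subst, single, wk_subst_single] at h'
  exact h'

theorem oneOf_intro {a : Ty n} {x A : Term K Γ a} {As : List (Term K Γ a)} (hA : A ∈ As)
    (h : Deriv H (.eq x A)) : Deriv H (.app (oneOf As) x) := by
  induction As with
  | nil => cases hA
  | cons A' As ih =>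
    refine eq_mp (app_oneOf_cons x A' As).symm ?_
    rcases List.mem_cons.1 hA with rfl | hA
    · exact disj_inl h
    · exact disj_inr (ih hA)

theorem oneOf_elim {a : Ty n} {x : Term K Γ a} {As : List (Term K Γ a)}
    (h : Deriv H (.app (oneOf As) x)) (h' : ∀ A ∈ As, Deriv (Insert.insert (.eq x A) H) P) :
    Deriv H P := by
  induction As generalizing H with
  | nil => exact (eq_mp (app_oneOf_nil x) h).ff_elim
  | cons A As ih =>
    refine disj_elim (eq_mp (app_oneOf_cons x A As) h) (h' A (by simp)) (ih assumption ?_)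
    intro A' hA'
    exact (h' A' (by simp [hA'])).mono (Set.insert_subset_insert (Set.subset_insert _ _))

end Deriv

/-! ### Definition by cases -/

namespace Term

/-- The term that denotes `x` if `A` holds and `y` otherwise, by means of description. -/
def cond {a : Ty n} (A : Term K Γ Ty.t) (x y : Term K Γ a) : Term K Γ a :=
  app (iota a) (lam (disj (conj (A.wk a) (eq (x.wk a) (bound .zero)))
    (conj (neg (A.wk a)) (eq (y.wk a) (bound .zero)))))

end Term

namespace Deriv

variable {H : Set (Term K Γ Ty.t)} {A : Term K Γ Ty.t} {a : Ty n}

/-- Given `A`, the second alternative is refuted, so the described predicate equals `λ z (x = z)`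
and the description axiom applies. -/
theorem cond_pos (x y : Term K Γ a) (h : Deriv H A) : Deriv H (.eq (cond A x y) x) := by
  refine trans (app (refl _) (lam (prop_ext ?_ ?_))) (iota_eq x)
  · refine disj_elim assumption assumption.conj_right ?_
    exact neg_elim assumption.conj_left (h.wk a).insert.insert
  · exact disj_inl (conj_intro (h.wk a).insert assumption)

theorem cond_neg (x y : Term K Γ a) (h : Deriv H (neg A)) : Deriv H (.eq (cond A x y) y) := by
  refine trans (app (refl _) (lam (prop_ext ?_ ?_))) (iota_eq y)
  · refine disj_elim assumption ?_ assumption.conj_right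
    exact neg_elim (h.wk a).insert.insert assumption.conj_left
  · exact disj_inr (conj_intro (h.wk a).insert assumption)

end Deriv

/-! ### Finite alternatives in logically closed sets, and evaluation of `L ⇒ R`. -/

section Symbolic

variable [n.AtLeastTwo] {N : ℕ} {C : Ty n → Type u} {D : Ty n → Type v} {a b : Ty n}

/-- A logically closed set contains every term that provably equals one of finitely many of its
elements. -/
theorem LogicallyClosed.mem_of_oneOf {M : Set (Tm N C a)} (hM : LogicallyClosed M)
    (hC : Consistent (∅ : Set (Tm N C Ty.t))) {As : List (Tm N C a)} (hAs : ∀ A ∈ As, A ∈ M)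
    {A : Tm N C a} (h : Proves ∅ (app (oneOf As) A)) : A ∈ M := by
  induction As generalizing A with
  | nil => exact absurd (Deriv.eq_mp (Deriv.app_oneOf_nil A) h) hC
  | cons B As ih =>
    have hB : B ∈ M := hAs B (by simp)
    have h' := Deriv.eq_mp (Deriv.app_oneOf_cons A B As) h
    rcases As with _ | ⟨B', As⟩
    · refine hM A B B hB hB (Deriv.disj_elim h' (Deriv.disj_inl Deriv.assumption) ?_)
      exact (Deriv.eq_mp (Deriv.app_oneOf_nil A) Deriv.assumption).ff_elim
    -- `E` is `A` when `A` equals a term of the tail, and `B'` otherwise. So `E` provably equals a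
    -- term of the tail in either case, and `A` is `B` or `E`. The default `B'` is why a one-element
    -- list is treated apart.
    · set E := cond (app (oneOf (B' :: As)) A) A B'
      have hmem : E ∈ M := by
        refine ih (fun A hA => hAs A (List.mem_cons_of_mem _ hA)) ?_
        refine Deriv.by_cases (app (oneOf (B' :: As)) A) ?_ ?_
        · exact Deriv.eq_mp (Deriv.app (Deriv.refl _)
            (Deriv.cond_pos A B' Deriv.assumption).symm) Deriv.assumption
        · exact Deriv.oneOf_intro (by simp) (Deriv.cond_neg A B' Deriv.assumption)
      refine hM A B E hB hmem (Deriv.disj_elim h' (Deriv.disj_inl Deriv.assumption) ?_)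
      exact Deriv.disj_inr (Deriv.cond_pos A B' Deriv.assumption).symm

theorem emb_oneOf (As : List (Tm N C a)) : emb D (oneOf As) = oneOf (As.map (emb D)) :=
  mapConst_oneOf _ As

variable {K : Ty n → Type u} {H : Set (Term K [] Ty.t)}

/-- `L w` is kept as one weakened block, so that a known equation for `L w` can be rewritten under
the binders. -/
theorem ruleApp_app (L : Term K [] (Ty.s ⇾ a ⇾ Ty.t)) (R : Term K [] (a ⇾ b ⇾ Ty.t))
    (w : Term K [] Ty.s) :
    Deriv H (eq (app (ruleApp L R) w) (lam (ex (conj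
      (app (((app L w).wk b).wk a) (bound .zero))
      (app (app ((R.wk b).wk a) (bound .zero)) (bound (.succ .zero))))))) := by
  have h : Deriv H (eq (ruleApp L R) _) := Deriv.app (Deriv.beta _ L) (Deriv.refl R)
  simp only [inst, subst] at h
  replace h := h.trans (Deriv.beta _ R)
  simp only [inst, subst] at h
  replace h := (Deriv.app h (Deriv.refl w)).trans (Deriv.beta _ w)
  simpa [inst, subst, liftSub, single, wk, rename, subst_rename, rename_subst, subst_bound,
    subst_bound_comp, rename_rename] using h

/-- Composition of a finite disjunction with a relation that takes finite disjunctions as values. -/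
theorem ruleApp_oneOf {L : Term K [] (Ty.s ⇾ a ⇾ Ty.t)} {R : Term K [] (a ⇾ b ⇾ Ty.t)}
    {w : Term K [] Ty.s} {ι : Type*} {l : List ι} (g : ι → Term K [] a)
    (f : ι → List (Term K [] b)) (hL : Deriv H (eq (app L w) (oneOf (l.map g))))
    (hR : ∀ i ∈ l, Deriv H (eq (app R (g i)) (oneOf (f i)))) :
    Deriv H (eq (app (ruleApp L R) w) (oneOf (l.flatMap f))) := by
  -- The disjunction is η-expanded, which leaves an equivalence of formulas at a variable of type
  -- `b`.
  refine (ruleApp_app L R w).trans (.symm (.trans (.symm (.eta _)) (.lam (.symm ?_))))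
  have hL1 := hL.wk b
  have hL2 := hL1.wk a
  have hR1 := fun i hi => (hR i hi).wk b
  have hR2 := fun i hi => (hR1 i hi).wk a
  simp only [eq_wk, app_wk, oneOf_wk] at hL1 hR1 hL2 hR2 ⊢
  refine .prop_ext (.ex_elim .assumption ?_) (.oneOf_elim .assumption ?_)
  · simp only [app_wk, oneOf_wk, Set.image_insert_eq]
    refine .oneOf_elim
      (.eq_mp (.app hL2.insert.insert (.refl _)) (Deriv.assumption.conj_left)) ?_
    intro A' hA'
    simp only [List.mem_map, exists_exists_and_eq_and] at hA'
    obtain ⟨i, hi, rfl⟩ := hA'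
    -- The equation of the bound variable with `g i` turns the second conjunct into a statement
    -- about `R (g i)`.
    refine .oneOf_elim (.eq_mp (.app (.trans (.app (.refl _) .assumption)
      (hR2 i hi).insert.insert.insert) (.refl _)) (Deriv.assumption.conj_right).insert) ?_
    intro B' hB'
    simp only [List.mem_map, exists_exists_and_eq_and] at hB'
    obtain ⟨B, hB, rfl⟩ := hB'
    exact .oneOf_intro
      (List.mem_map.2 ⟨_, List.mem_map.2 ⟨B, List.mem_flatMap.2 ⟨i, hi, hB⟩, rfl⟩, rfl⟩) .assumption
  · intro B' hB'
    obtain ⟨B, hB, rfl⟩ := List.mem_map.1 hB'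
    obtain ⟨i, hi, hB⟩ := List.mem_flatMap.1 hB
    refine .ex_intro ((g i).wk b) ?_
    simp only [inst, conj_subst, subst, single, wk_subst_single]
    refine .conj_intro ?_ ?_
    · exact .eq_mp (Deriv.app hL1.insert.insert (.refl _)).symm
        (.oneOf_intro (List.mem_map_of_mem (List.mem_map_of_mem hi)) (.refl _))
    · exact .eq_mp (Deriv.app (hR1 i hi).insert.insert (.refl _)).symm
        (.oneOf_intro (List.mem_map_of_mem hB) .assumption)

end Symbolic

end TyN

open TyN TyN.Term

theorem proposition7p8 {n : ℕ} [n.AtLeastTwo] {N : ℕ}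
    {C : TyN.Ty n → Type u} {D : TyN.Ty n → Type v} {a b : TyN.Ty n}
    (𝓛 : TyN.Language N C a) (𝓡 : TyN.Rule N C a b)
    (Δ : Set (TyN.Tm N (TyN.Plus C D) TyN.Ty.t))
    (L : TyN.Tm N (TyN.Plus C D) (TyN.Ty.fn TyN.Ty.s (TyN.Ty.fn a TyN.Ty.t)))
    (R : TyN.Tm N C (TyN.Ty.fn a (TyN.Ty.fn b TyN.Ty.t)))
    (hL : 𝓛.IsPseudoCanonicRep Δ L) (hR : 𝓡.IsCanonicRep 𝓛.range R) :
    (𝓛.applyRule 𝓡).IsRepresentedBy Δ (TyN.ruleApp L (TyN.emb D R)) ∧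
      (𝓛.applyRule 𝓡).IsPseudoCanonicRep Δ (TyN.ruleApp L (TyN.emb D R)) := by
  obtain ⟨⟨hcons, hmem⟩, hone, hcsv⟩ := hL
  obtain ⟨hclosed, hRmem, hRone⟩ := hR
  -- Falsehood embeds to falsehood, so conservativity transfers consistency to `Ty_n^𝒜`.
  have hcons' : Consistent (∅ : Set (Tm N C Ty.t)) := fun h => hcons ((hcsv _).1 h)
  -- The empty list is a dummy value outside the range, making the choice of lists a total function.
  have hRone' : ∀ A, ∃ Bs, A ∈ 𝓛.range → Proves ∅ (eq (app R A) (oneOf Bs)) := fun A => by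
    by_cases hA : A ∈ 𝓛.range
    · exact (hRone A hA).imp fun _ h _ => h
    · exact ⟨[], fun h => absurd h hA⟩
  choose f hf using hRone'
  have key (w : List (Fin N)) : ∃ As : List (Tm N C a), (∀ A ∈ As, (w, A) ∈ 𝓛) ∧
      Proves Δ (eq (app (ruleApp L (emb D R)) (wordTerm w))
        (oneOf ((As.flatMap f).map (emb D)))) := by
    obtain ⟨As, hAs⟩ := hone w
    have hAs' : ∀ A ∈ As, (w, A) ∈ 𝓛 := fun A hA => (hmem w A).2 <|
      Deriv.eq_mp (Deriv.app hAs (Deriv.refl _)).symm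
        (Deriv.oneOf_intro (List.mem_map_of_mem hA) (Deriv.refl _))
    refine ⟨As, hAs', ?_⟩
    rw [List.map_flatMap]
    -- The index type is that of the `Ty_n^𝒜` terms, since `f` is defined on these and not on their
    -- embeddings.
    refine ruleApp_oneOf (emb D) _ hAs fun A hA => ?_
    rw [← emb_oneOf]
    exact (hcsv _).1 (hf A ⟨w, hAs' A hA⟩)
  have hrep : (𝓛.applyRule 𝓡).IsRepresentedBy Δ (ruleApp L (emb D R)) := by
    refine ⟨hcons, fun w B => ⟨?_, fun h => ?_⟩⟩
    · rintro ⟨A, hA, hAB⟩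
      refine Deriv.eq_mp (Deriv.app (ruleApp_app _ _ _) (Deriv.refl _)).symm
        (Deriv.eq_mp (Deriv.beta _ _).symm (Deriv.ex_intro (emb D A) ?_))
      have hA' := (hmem w A).1 hA
      have hAB' := (hcsv _).1 ((hRmem A B).1 hAB)
      have hconj : Proves Δ (conj (app (app L (wordTerm w)) (emb D A))
        (app (app (emb D R) (emb D A)) (emb D B))) := Deriv.conj_intro hA' hAB'
      simpa only [Proves, inst, conj_subst, subst, wk_subst, wk_subst_single, liftSub, single]
        using hconj
    · obtain ⟨As, hAs, h'⟩ := key w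
      -- Conservativity moves the disjunction of equations to `Δ`, where either equation can be
      -- substituted in `L T(w)`.
      have hM : LogicallyClosed {A | (w, A) ∈ 𝓛} := by
        intro A A₁ A₂ h₁ h₂ hd
        have hd' := (hcsv _).1 hd
        rw [emb, mapConst_disj] at hd'
        refine (hmem w A).2 (Deriv.disj_elim hd' ?_ ?_)
        · exact Deriv.eq_mp (Deriv.app (Deriv.refl _) Deriv.assumption.symm)
            ((hmem w A₁).1 h₁).insert
        · exact Deriv.eq_mp (Deriv.app (Deriv.refl _) Deriv.assumption.symm)
            ((hmem w A₂).1 h₂).insert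
      have hB := Deriv.eq_mp (Deriv.app h' (Deriv.refl _)) h
      rw [← emb_oneOf] at hB
      -- Conservativity is used here in the converse direction: the disjunction for `B` must be
      -- provable without `Δ` for logical closure to apply.
      refine (hclosed _ hM).mem_of_oneOf hcons' (As := As.flatMap f) ?_ ((hcsv _).2 hB)
      intro B' hB'
      obtain ⟨A, hA, hAB⟩ := List.mem_flatMap.1 hB'
      exact ⟨A, hAs A hA, (hRmem A B').2 (Deriv.eq_mp
        (Deriv.app (hf A ⟨w, hAs A hA⟩) (Deriv.refl _)).symm
        (Deriv.oneOf_intro hAB (Deriv.refl _)))⟩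
  exact ⟨hrep, hrep, fun w => (key w).imp' _ fun _ h => h.2, hcsv⟩
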